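/- Let $p$ be a prime and let $B$ be the quaternion algebra over $\mathbb Q$ (unique up to isomorphism) that ramifies exactly at $p$ and $\infty$, that is, $B\otimes_{\mathbb Q}\mathbb R$ is a division algebra and, for a prime $\ell$, $B\otimes_{\mathbb Q}\mathbb Q_\ell$ is a division algebra if and only if $\ell=p$. Write $\overline{\alpha}$ for the standard conjugate of $\alpha\in B$ and $\operatorname{nrd}(\alpha)=\alpha\overline{\alpha}\in\mathbb Q$ for its reduced norm. An ideal of $B$ is an additive subgroup generated by a $\mathbb Q$-basis of $B$. An order is an ideal that contains $1$ and is closed under multiplication; it is maximal if no order properly contains it. An ideal $I$ is integral if it is closed under multiplication; its reduced norm is then $\operatorname{nrd}(I)=\gcd\{\operatorname{nrd}(\alpha):\alpha\in I\}$. An ideal $I$ links $\mathfrak O$ to $\mathfrak O'$ if $\{x\in B: xI\subseteq I\}=\mathfrak O$ and $\{x\in B: Ix\subseteq I\}=\mathfrak O'$. Lemma 4.2. If $\mathfrak O,\mathfrak O'\subseteq B$ are maximal orders, then the following quantities are all equal (to one positive integer, the distance $d(\mathfrak O,\mathfrak O')$): (a) the index $[\mathfrak O:\mathfrak O\cap\mathfrak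 O']$; (b) the index $[\mathfrak O':\mathfrak O\cap\mathfrak O']$; (c) the smallest reduced norm of an integral ideal linking $\mathfrak O$ to $\mathfrak O'$. -/

import Mathlib

open scoped Quaternion

namespace QuatOrder

/-- Every nonzero element is invertible: the ring is a division ring. -/
def IsDivisionAlgebra (A : Type*) [Ring A] : Prop :=
  Nontrivial A ∧ ∀ x : A, x ≠ 0 → IsUnit x

/-- The quaternion algebra `(a, b | ℚ)`, with `i² = a`, `j² = b`, `k = ij = -ji`, ramifies exactly
at `p` and `∞`.  Its completion at a place `v` is `(a, b | ℚ_v)`, and it ramifies at `v` if this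
completion is a division algebra. -/
structure RamifiesExactlyAt (a b : ℚ) (p : ℕ) : Prop where
  left_ne_zero : a ≠ 0
  right_ne_zero : b ≠ 0
  ramified_infinite : IsDivisionAlgebra ℍ[ℝ, (a : ℝ), (b : ℝ)]
  ramified_finite_iff : ∀ (l : ℕ) [Fact l.Prime],
    IsDivisionAlgebra ℍ[ℚ_[l], (a : ℚ_[l]), (b : ℚ_[l])] ↔ l = p

variable {a b : ℚ}

/-- The reduced norm of `α`: the rational number `α * conj α`. -/
def nrd (α : ℍ[ℚ, a, b]) : ℚ := (α * star α).re

/-- An ideal (full lattice) of `B`: an additive subgroup generated by a `ℚ`-basis of `B`. -/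
def IsIdeal (I : AddSubgroup ℍ[ℚ, a, b]) : Prop :=
  ∃ e : Module.Basis (Fin 4) ℚ ℍ[ℚ, a, b], I = AddSubgroup.closure (Set.range e)

/-- An order of `B`: an ideal which contains `1` and is closed under multiplication. -/
def IsOrder (O : AddSubgroup ℍ[ℚ, a, b]) : Prop :=
  IsIdeal O ∧ 1 ∈ O ∧ ∀ x ∈ O, ∀ y ∈ O, x * y ∈ O

/-- A maximal order: an order not properly contained in any order. -/
def IsMaximalOrder (O : AddSubgroup ℍ[ℚ, a, b]) : Prop :=
  Maximal IsOrder O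

/-- The left order `{x ∈ B : x I ⊆ I}` of `I`. -/
def leftOrder (I : AddSubgroup ℍ[ℚ, a, b]) : AddSubgroup ℍ[ℚ, a, b] where
  carrier := {x | ∀ y ∈ I, x * y ∈ I}
  zero_mem' := fun y _ => by simp [I.zero_mem]
  add_mem' := fun hx hx' y hy => by
    rw [add_mul]; exact I.add_mem (hx y hy) (hx' y hy)
  neg_mem' := fun hx y hy => by
    rw [neg_mul]; exact I.neg_mem (hx y hy)

/-- The right order `{x ∈ B : I x ⊆ I}` of `I`. -/
def rightOrder (I : AddSubgroup ℍ[ℚ, a, b]) : AddSubgroup ℍ[ℚ, a, b] where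
  carrier := {x | ∀ y ∈ I, y * x ∈ I}
  zero_mem' := fun y _ => by simp [I.zero_mem]
  add_mem' := fun hx hx' y hy => by
    rw [mul_add]; exact I.add_mem (hx y hy) (hx' y hy)
  neg_mem' := fun hx y hy => by
    rw [mul_neg]; exact I.neg_mem (hx y hy)

/-- An integral ideal: an ideal which is closed under multiplication. -/
def IsIntegralIdeal (I : AddSubgroup ℍ[ℚ, a, b]) : Prop :=
  IsIdeal I ∧ ∀ x ∈ I, ∀ y ∈ I, x * y ∈ I

/-- `I` links `O` to `O'`: its left order is `O` and its right order is `O'`. -/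
def Links (I O O' : AddSubgroup ℍ[ℚ, a, b]) : Prop :=
  leftOrder I = O ∧ rightOrder I = O'

/-- `n` divides all the reduced norms of elements of `I`, that is, all of them lie in `n ℤ`. -/
def DividesNorms (n : ℕ) (I : AddSubgroup ℍ[ℚ, a, b]) : Prop :=
  ∀ α ∈ I, ∃ k : ℤ, nrd α = (n : ℚ) * (k : ℚ)

/-- `n` is the reduced norm of `I`, i.e. the (nonnegative) greatest common divisor of the reduced
norms of the elements of `I`; in particular these norms are all integers. -/
def IsReducedNorm (I : AddSubgroup ℍ[ℚ, a, b]) (n : ℕ) : Prop :=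
  DividesNorms n I ∧ ∀ m : ℕ, DividesNorms m I → m ∣ n

end QuatOrder

/-! The common value is the positive integer `m` for which the reduced norms on the lattice `O O'`
generate `(1/m) ℤ`. The input from maximality is that an element `t` with `nrd t` and all `trd (x
t)`, `x ∈ O`, integral lies in `O`, because `O + O t O` is then an order. Applied to `m x ȳ` with
`x, y ∈ O O'`, this gives `m O O' O ⊆ O`; equality holds because the norms on `O O'` generate `1/m`
(`IsDistance.scalar_mul_eq`).

Put `I = m O O'` and `I' = m O' O`, its conjugate. Then `I O = O`, `O' I = O'`, `I I = I` and `I I'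
= m O`. The trace pairing modulo `m` puts `O / I` in duality with `I' / m O`, so `[O : I]² = [O : m
O] = m⁴` (`relIndex_linking`). Moreover `O ∩ O' = ℤ + I` and `ℤ ∩ I = m ℤ`, so `[O ∩ O' : I] = m`,
which leaves `[O : O ∩ O'] = m` (`relIndex_inf`); the other index follows by symmetry.

The ideal `I` is integral, links `O` to `O'` and has norm `m`. Any integral linking ideal of norm
`n` contains `n O O'`, and comparing norms gives `m ∣ n` (`dvd_of_links`). -/

open scoped Quaternion

namespace QuatOrder

/-! ### Identities for the reduced norm and trace. -/

section Norms

variable {a b : ℚ}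

/-- The reduced trace. -/
def trd (x : ℍ[ℚ, a, b]) : ℚ := 2 * x.re

theorem mul_star_eq_nrd_smul (x : ℍ[ℚ, a, b]) : x * star x = nrd x • 1 := by
  ext <;> simp [nrd]; all_goals ring

theorem star_mul_eq_nrd_smul (x : ℍ[ℚ, a, b]) : star x * x = nrd x • 1 := by
  ext <;> simp [nrd]; all_goals ring

theorem self_add_star_eq_trd_smul (x : ℍ[ℚ, a, b]) : x + star x = trd x • 1 := by
  ext <;> simp [trd]; ring

theorem star_eq_trd_smul_sub (x : ℍ[ℚ, a, b]) : star x = trd x • 1 - x := by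
  rw [← self_add_star_eq_trd_smul]; abel

theorem nrd_mul (x y : ℍ[ℚ, a, b]) : nrd (x * y) = nrd x * nrd y := by
  simp [nrd]; ring

theorem nrd_add (x y : ℍ[ℚ, a, b]) : nrd (x + y) = nrd x + nrd y + trd (x * star y) := by
  simp [nrd, trd]; ring

theorem nrd_star (x : ℍ[ℚ, a, b]) : nrd (star x) = nrd x := by
  simp [nrd]

theorem nrd_smul (q : ℚ) (x : ℍ[ℚ, a, b]) : nrd (q • x) = q ^ 2 * nrd x := by
  simp [nrd]; ring

theorem nrd_one : nrd (1 : ℍ[ℚ, a, b]) = 1 := by simp [nrd]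

theorem trd_mul_comm (x y : ℍ[ℚ, a, b]) : trd (x * y) = trd (y * x) := by
  simp [trd]; ring

theorem trd_add (x y : ℍ[ℚ, a, b]) : trd (x + y) = trd x + trd y := by
  simp [trd]; ring

theorem trd_smul (q : ℚ) (x : ℍ[ℚ, a, b]) : trd (q • x) = q * trd x := by
  simp [trd]; ring

theorem trd_one : trd (1 : ℍ[ℚ, a, b]) = 2 := by simp [trd]

theorem trd_star (x : ℍ[ℚ, a, b]) : trd (star x) = trd x := by simp [trd]

/-- This is `yz + z̄ ȳ = trd (yz)` multiplied by `x` on the left. When `x z̄` is under control, it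
reduces `x y z` to a multiple of `x` and a known term. -/
theorem mul_mul_eq_trd_smul_sub (x y z : ℍ[ℚ, a, b]) :
    x * y * z = trd (y * z) • x - x * star z * star y := by
  have h := self_add_star_eq_trd_smul (y * z)
  rw [star_mul] at h
  calc x * y * z = x * (y * z + star z * star y) - x * star z * star y := by noncomm_ring
    _ = _ := by rw [h, mul_smul_comm, mul_one]

/-- The reduced trace as a linear form. -/
def trdHom : ℍ[ℚ, a, b] →ₗ[ℚ] ℚ where
  toFun := trd
  map_add' := trd_add
  map_smul' := trd_smul

end Norms

/-! ### Full lattices and the denominators of their norms. -/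

section Lattices

variable {a b : ℚ}

/-- A finitely generated spanning ℤ-module is free of rank 4, and its ℤ-basis is a ℚ-basis. This
form is easy to check for sums and products of lattices. -/
theorem isIdeal_iff {L : Submodule ℤ ℍ[ℚ, a, b]} :
    IsIdeal L.toAddSubgroup ↔ L.FG ∧ Submodule.span ℚ (L : Set ℍ[ℚ, a, b]) = ⊤ := by
  constructor
  · rintro ⟨e, he⟩
    have hL : L = Submodule.span ℤ (Set.range e) := by
      apply Submodule.toAddSubgroup_injective
      rw [he, Submodule.span_int_eq_addSubgroupClosure]
    refine ⟨hL ▸ Submodule.fg_span (Set.finite_range e), ?_⟩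
    rw [hL, Submodule.span_span_of_tower, e.span_eq]
  · rintro ⟨h1, h2⟩
    have : Submodule.IsLattice ℚ L := ⟨h1, h2⟩
    have := Submodule.IsLattice.free ℚ L
    have hr : Module.finrank ℤ L = 4 :=
      (Module.finrank_eq_of_rank_eq ((Submodule.IsLattice.rank' ℚ L).trans
        (by rw [QuaternionAlgebra.rank_eq_four]; rfl)))
    let e := Module.finBasisOfFinrankEq ℤ L hr
    refine ⟨e.extendOfIsLattice ℚ, ?_⟩
    have h3 : Set.range (e.extendOfIsLattice ℚ) = L.subtype '' Set.range e := by
      rw [← Set.range_comp]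
      congr 1
      ext1 k
      simp
    rw [h3, ← Submodule.span_int_eq_addSubgroupClosure, ← Submodule.map_span, e.span_eq]
    simp

theorem IsIdeal.of_le {L M : Submodule ℤ ℍ[ℚ, a, b]} (hL : IsIdeal L.toAddSubgroup) (h : L ≤ M)
    (hM : M.FG) : IsIdeal M.toAddSubgroup := by
  rw [isIdeal_iff] at hL ⊢
  exact ⟨hM, top_unique (hL.2 ▸ Submodule.span_mono h)⟩

theorem exists_smul_mem_of_span_eq_top {L : Submodule ℤ ℍ[ℚ, a, b]}
    (h : Submodule.span ℚ (L : Set ℍ[ℚ, a, b]) = ⊤) (x : ℍ[ℚ, a, b]) :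
    ∃ n : ℕ, 0 < n ∧ (n : ℚ) • x ∈ L := by
  have hx : x ∈ Submodule.span ℚ (L : Set ℍ[ℚ, a, b]) := h ▸ Submodule.mem_top
  induction hx using Submodule.span_induction with
  | mem x hx => exact ⟨1, one_pos, by simpa using hx⟩
  | zero => exact ⟨1, one_pos, by simp⟩
  | add x y _ _ hx hy =>
    obtain ⟨n, hn, hx⟩ := hx
    obtain ⟨m, hm, hy⟩ := hy
    refine ⟨n * m, Nat.mul_pos hn hm, ?_⟩
    have h1 := L.add_mem (L.smul_mem (m : ℤ) hx) (L.smul_mem (n : ℤ) hy)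
    convert h1 using 1
    simp only [← Int.cast_smul_eq_zsmul ℚ]
    push_cast
    module
  | smul q x _ hx =>
    obtain ⟨n, hn, hx⟩ := hx
    refine ⟨q.den * n, Nat.mul_pos q.den_pos hn, ?_⟩
    have h1 := L.smul_mem q.num hx
    convert h1 using 1
    simp only [← Int.cast_smul_eq_zsmul ℚ, smul_smul]
    congr 1
    push_cast
    rw [mul_right_comm, mul_comm (q.den : ℚ), Rat.mul_den_eq_num]

/-- A finitely generated lattice has reduced norms with bounded denominators. -/
theorem exists_nrd_denominator {L : Submodule ℤ ℍ[ℚ, a, b]} (hL : L.FG) :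
    ∃ N : ℕ, 0 < N ∧ ∀ x ∈ L, ∃ k : ℤ, N * nrd x = k := by
  have h2 : (L * L.map (starAddEquiv (R := ℍ[ℚ, a, b])).toAddMonoidHom.toIntLinearMap).FG :=
    hL.mul (hL.map _)
  obtain ⟨s, hs⟩ := h2.map (trdHom (a := a) (b := b)).toAddMonoidHom.toIntLinearMap
  have key : ∀ s : Finset ℚ, ∃ N : ℕ, 0 < N ∧
      ∀ q ∈ Submodule.span ℤ (s : Set ℚ), ∃ k : ℤ, N * q = k := by
    intro s
    refine ⟨∏ q ∈ s, q.den, Finset.prod_pos fun q _ => q.den_pos, fun q hq => ?_⟩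
    induction hq using Submodule.span_induction with
    | mem q hq =>
      obtain ⟨c, hc⟩ := Finset.dvd_prod_of_mem (fun q : ℚ => q.den) hq
      refine ⟨c * q.num, ?_⟩
      rw [hc]
      push_cast
      rw [← Rat.mul_den_eq_num]
      ring
    | zero => exact ⟨0, by simp⟩
    | add x y _ _ hx hy =>
      obtain ⟨k, hk⟩ := hx
      obtain ⟨l, hl⟩ := hy
      exact ⟨k + l, by rw [mul_add, hk, hl]; push_cast; rfl⟩
    | smul c x _ hx =>
      obtain ⟨k, hk⟩ := hx
      exact ⟨c * k, by rw [zsmul_eq_mul, mul_left_comm, hk]; push_cast; rfl⟩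
  obtain ⟨N, hN, h⟩ := key s
  -- The factor 2 comes from `trd (x x̄) = 2 nrd x`.
  refine ⟨N * 2, by positivity, fun x hx => ?_⟩
  obtain ⟨k, hk⟩ := h (trd (x * star x)) (by
    rw [hs]
    exact ⟨x * star x, Submodule.mul_mem_mul hx ⟨x, hx, rfl⟩, rfl⟩)
  refine ⟨k, ?_⟩
  rw [← hk, mul_star_eq_nrd_smul, trd_smul, trd_one]
  push_cast; ring

/-- The reduced norms of a lattice generate a cyclic group. -/
theorem exists_closure_nrd_eq_zmultiples {L : Submodule ℤ ℍ[ℚ, a, b]} (hL : L.FG) :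
    ∃ g : ℚ, AddSubgroup.closure (nrd '' (L : Set ℍ[ℚ, a, b])) = AddSubgroup.zmultiples g := by
  obtain ⟨N, hN, h⟩ := exists_nrd_denominator hL
  have hN' : (N : ℚ) ≠ 0 := by positivity
  set G := AddSubgroup.closure (nrd '' (L : Set ℍ[ℚ, a, b]))
  let f : ℤ →+ ℚ := (AddMonoidHom.mulRight ((N : ℚ)⁻¹)).comp (Int.castAddHom ℚ)
  have hG : G ≤ f.range := by
    rw [AddSubgroup.closure_le]
    rintro _ ⟨x, hx, rfl⟩
    obtain ⟨k, hk⟩ := h x hx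
    exact ⟨k, by simp [f, ← hk]; field_simp⟩
  obtain ⟨g, hg⟩ := Int.subgroup_cyclic (G.comap f)
  refine ⟨f g, ?_⟩
  rw [← AddMonoidHom.map_zmultiples, AddSubgroup.zmultiples_eq_closure, ← hg,
    AddSubgroup.map_comap_eq, inf_eq_right.2 hG]

end Lattices

/-! ### Integrality in orders and the criterion for membership in a maximal order. -/

section Orders

variable {a b : ℚ} {O : Submodule ℤ ℍ[ℚ, a, b]}

/-- Every power of the denominator is coprime to the numerator, hence divides `N`; a denominator
above 1 would have powers exceeding `N`. -/
theorem exists_eq_intCast_of_forall_pow {N : ℕ} (hN : 0 < N) {q : ℚ}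
    (h : ∀ k : ℕ, ∃ z : ℤ, N * q ^ k = z) : ∃ z : ℤ, q = z := by
  have h1 : ∀ k : ℕ, q.den ^ k ∣ N := by
    intro k
    obtain ⟨z, hz⟩ := h k
    have h2 : (N : ℤ) * q.num ^ k = z * (q.den : ℤ) ^ k := by
      have h3 : (N : ℚ) * (q.num : ℚ) ^ k = z * (q.den : ℚ) ^ k := by
        rw [← hz, ← Rat.mul_den_eq_num, mul_pow]; ring
      exact_mod_cast h3
    have h4 : ((q.den : ℤ) ^ k) ∣ N * q.num ^ k := ⟨z, by rw [h2]; ring⟩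
    have h5 : IsCoprime ((q.den : ℤ) ^ k) (q.num ^ k) := by
      apply IsCoprime.pow
      rw [Int.isCoprime_iff_gcd_eq_one, Int.gcd_comm]
      exact q.reduced
    exact_mod_cast h5.dvd_of_dvd_mul_right h4
  have h6 : q.den = 1 := by
    by_contra hne
    have h7 : 1 < q.den := lt_of_le_of_ne q.den_pos (Ne.symm hne)
    exact absurd (Nat.le_of_dvd hN (h1 N)) (not_le.2 (Nat.lt_pow_self h7))
  exact ⟨q.num, (Rat.coe_int_num_of_den_eq_one h6).symm⟩

theorem IsOrder.exists_nrd_eq (hO : IsOrder O.toAddSubgroup) {x : ℍ[ℚ, a, b]} (hx : x ∈ O) :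
    ∃ k : ℤ, nrd x = k := by
  obtain ⟨N, hN, h⟩ := exists_nrd_denominator (isIdeal_iff.1 hO.1).1
  refine exists_eq_intCast_of_forall_pow hN fun k => ?_
  have h1 : x ^ k ∈ O ∧ nrd (x ^ k) = nrd x ^ k := by
    induction k with
    | zero => exact ⟨by simpa using hO.2.1, by simp [nrd_one]⟩
    | succ k ih =>
      rw [pow_succ, pow_succ, nrd_mul, ih.2]
      exact ⟨hO.2.2 _ ih.1 _ hx, rfl⟩
  rw [← h1.2]
  exact h _ h1.1

theorem IsOrder.exists_trd_eq (hO : IsOrder O.toAddSubgroup) {x : ℍ[ℚ, a, b]} (hx : x ∈ O) :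
    ∃ k : ℤ, trd x = k := by
  obtain ⟨k, hk⟩ := hO.exists_nrd_eq (O.add_mem hx hO.2.1)
  obtain ⟨l, hl⟩ := hO.exists_nrd_eq hx
  refine ⟨k - l - 1, ?_⟩
  have h := nrd_add x 1
  rw [star_one, mul_one, nrd_one] at h
  push_cast
  linarith

theorem IsOrder.star_mem (hO : IsOrder O.toAddSubgroup) {x : ℍ[ℚ, a, b]} (hx : x ∈ O) :
    star x ∈ O := by
  obtain ⟨k, hk⟩ := hO.exists_trd_eq hx
  rw [star_eq_trd_smul_sub, hk, Int.cast_smul_eq_zsmul]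
  exact O.sub_mem (O.smul_mem k hO.2.1) hx

theorem IsOrder.mul_self (hO : IsOrder O.toAddSubgroup) : O * O = O := by
  apply le_antisymm (Submodule.mul_le.2 hO.2.2)
  intro x hx
  simpa using Submodule.mul_mem_mul hx (hO.2.1 : (1 : ℍ[ℚ, a, b]) ∈ O)

/-- An element of integral norm which pairs integrally with a maximal order lies in it. -/
theorem IsMaximalOrder.mem_of_trd (hO : IsMaximalOrder O.toAddSubgroup) {t : ℍ[ℚ, a, b]}
    (hn : ∃ k : ℤ, nrd t = k) (ht : ∀ x ∈ O, ∃ k : ℤ, trd (x * t) = k) : t ∈ O := by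
  have hO1 : IsOrder O.toAddSubgroup := hO.1
  have hOO := hO1.mul_self
  have one_mem : (1 : ℍ[ℚ, a, b]) ∈ O := hO1.2.1
  set T : Submodule ℤ ℍ[ℚ, a, b] := Submodule.span ℤ {t}
  have tT : t ∈ T := Submodule.mem_span_singleton_self t
  -- For `x ∈ O`, `t x t = trd (x t) t - nrd t x̄`, with both coefficients integral. This is what
  -- makes `O + O t O` closed under multiplication.
  have hTOT : T * O * T ≤ T ⊔ O := by
    rw [Submodule.mul_le]
    intro y hy z hz
    obtain ⟨c, rfl⟩ := Submodule.mem_span_singleton.1 hz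
    obtain ⟨x, hx, rfl⟩ := Submodule.mem_span_singleton_mul.1 hy
    rw [mul_smul_comm]
    apply Submodule.smul_mem
    obtain ⟨k, hk⟩ := ht x hx
    obtain ⟨l, hl⟩ := hn
    rw [mul_mul_eq_trd_smul_sub, mul_star_eq_nrd_smul, hk, hl, smul_mul_assoc, one_mul,
      Int.cast_smul_eq_zsmul, Int.cast_smul_eq_zsmul]
    exact Submodule.sub_mem _ (Submodule.smul_mem _ _ (Submodule.mem_sup_left tT))
      (Submodule.smul_mem _ _ (Submodule.mem_sup_right (hO1.star_mem hx)))
  set S := O ⊔ O * T * O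
  have hS : IsOrder S.toAddSubgroup := by
    have hfg := (isIdeal_iff.1 hO1.1).1
    refine ⟨hO1.1.of_le le_sup_left (hfg.sup ((hfg.mul (Submodule.fg_span_singleton t)).mul hfg)),
      Submodule.mem_sup_left one_mem, ?_⟩
    have h : S * S ≤ S := by
      have h1 : O * T * O * (O * T * O) ≤ S := by
        calc O * T * O * (O * T * O) = O * (T * (O * O) * T) * O := by simp only [mul_assoc]
          _ ≤ O * (T ⊔ O) * O := by rw [hOO]; gcongr
          _ = S := by rw [Submodule.mul_sup, Submodule.sup_mul, hOO, hOO, sup_comm]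
      simp only [S, Submodule.mul_sup, Submodule.sup_mul]
      refine sup_le (sup_le ?_ ?_) (sup_le ?_ h1)
      · rw [hOO]; exact le_sup_left
      · rw [mul_assoc _ O O, hOO]; exact le_sup_right
      · rw [← mul_assoc, ← mul_assoc, hOO]; exact le_sup_right
    intro x hx y hy
    exact h (Submodule.mul_mem_mul hx hy)
  have hle : S ≤ O := hO.2 hS (le_sup_left : O ≤ S)
  apply hle
  apply Submodule.mem_sup_right
  simpa using Submodule.mul_mem_mul (Submodule.mul_mem_mul one_mem tT) one_mem

/-- If all norms of a left module `L` of a maximal order `O` lie in `ν ℤ`, then `L L̄ ⊆ ν O`. -/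
theorem IsMaximalOrder.mul_star_mem (hO : IsMaximalOrder O.toAddSubgroup)
    {L : Submodule ℤ ℍ[ℚ, a, b]} (hL : O * L ≤ L) {ν : ℚ} (hν : ν ≠ 0)
    (h : ∀ x ∈ L, ∃ k : ℤ, nrd x = ν * k) {x y : ℍ[ℚ, a, b]} (hx : x ∈ L) (hy : y ∈ L) :
    ν⁻¹ • (x * star y) ∈ O := by
  apply hO.mem_of_trd
  · obtain ⟨k, hk⟩ := h x hx
    obtain ⟨l, hl⟩ := h y hy
    refine ⟨k * l, ?_⟩
    rw [nrd_smul, nrd_mul, nrd_star, hk, hl]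
    push_cast
    field_simp
  · intro o ho
    have hox : o * x ∈ L := hL (Submodule.mul_mem_mul ho hx)
    obtain ⟨k, hk⟩ := h _ hox
    obtain ⟨l, hl⟩ := h _ hy
    obtain ⟨m, hm⟩ := h _ (L.add_mem hox hy)
    -- Polarization: the trace is `nrd (ox + y) - nrd (ox) - nrd y`, a multiple of `ν`.
    refine ⟨m - k - l, ?_⟩
    have h1 := nrd_add (o * x) y
    rw [mul_smul_comm, trd_smul, ← mul_assoc]
    have h2 : trd (o * x * star y) = ν * (m - k - l) := by linarith
    rw [h2]
    push_cast
    field_simp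

end Orders

/-! ### Conjugation and integer scaling of lattices. -/

section ScaleConj

variable {a b : ℚ}

/-- The image of a lattice under conjugation. -/
def conj (L : Submodule ℤ ℍ[ℚ, a, b]) : Submodule ℤ ℍ[ℚ, a, b] :=
  L.map (starAddEquiv (R := ℍ[ℚ, a, b])).toAddMonoidHom.toIntLinearMap

theorem star_mem_conj {L : Submodule ℤ ℍ[ℚ, a, b]} {x : ℍ[ℚ, a, b]} (hx : x ∈ L) :
    star x ∈ conj L := ⟨x, hx, rfl⟩

theorem mem_conj {L : Submodule ℤ ℍ[ℚ, a, b]} {x : ℍ[ℚ, a, b]} : x ∈ conj L ↔ star x ∈ L := by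
  constructor
  · rintro ⟨y, hy, rfl⟩
    change star (star y) ∈ L
    rwa [star_star]
  · intro h
    simpa using star_mem_conj h

theorem conj_conj (L : Submodule ℤ ℍ[ℚ, a, b]) : conj (conj L) = L := by
  ext x; simp [mem_conj]

theorem conj_mono {L M : Submodule ℤ ℍ[ℚ, a, b]} (h : L ≤ M) : conj L ≤ conj M :=
  Submodule.map_mono h

theorem conj_mul_le (L M : Submodule ℤ ℍ[ℚ, a, b]) : conj (L * M) ≤ conj M * conj L := by
  intro x hx
  rw [mem_conj] at hx
  rw [← star_star x]
  generalize star x = w at hx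
  induction hx using Submodule.mul_induction_on' with
  | mem_mul_mem y hy z hz =>
    rw [star_mul]
    exact Submodule.mul_mem_mul (star_mem_conj hz) (star_mem_conj hy)
  | add y _ z _ hy hz => rw [star_add]; exact Submodule.add_mem _ hy hz

theorem conj_mul (L M : Submodule ℤ ℍ[ℚ, a, b]) : conj (L * M) = conj M * conj L := by
  apply le_antisymm (conj_mul_le L M)
  have h := conj_mono (conj_mul_le (conj M) (conj L))
  rwa [conj_conj, conj_conj, conj_conj] at h

theorem IsOrder.conj_eq {O : Submodule ℤ ℍ[ℚ, a, b]} (hO : IsOrder O.toAddSubgroup) :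
    conj O = O := by
  ext x
  rw [mem_conj]
  exact ⟨fun h => star_star x ▸ hO.star_mem h, fun h => hO.star_mem h⟩

/-- The lattice spanned by an integer; multiplying by it rescales a lattice. -/
def scalar (a b : ℚ) (n : ℕ) : Submodule ℤ ℍ[ℚ, a, b] := Submodule.span ℤ {(n : ℍ[ℚ, a, b])}

theorem mem_scalar_mul {n : ℕ} {L : Submodule ℤ ℍ[ℚ, a, b]} {x : ℍ[ℚ, a, b]} :
    x ∈ scalar a b n * L ↔ ∃ y ∈ L, (n : ℚ) • y = x := by
  rw [scalar, Submodule.mem_span_singleton_mul]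
  simp [Nat.cast_smul_eq_nsmul]

theorem mem_scalar_mul_iff {n : ℕ} (hn : 0 < n) {L : Submodule ℤ ℍ[ℚ, a, b]} {x : ℍ[ℚ, a, b]} :
    x ∈ scalar a b n * L ↔ (n : ℚ)⁻¹ • x ∈ L := by
  have hn' : (n : ℚ) ≠ 0 := by positivity
  rw [mem_scalar_mul]
  constructor
  · rintro ⟨y, hy, rfl⟩
    rwa [inv_smul_smul₀ hn']
  · intro h
    exact ⟨_, h, smul_inv_smul₀ hn' x⟩

theorem smul_mem_scalar_mul (n : ℕ) {L : Submodule ℤ ℍ[ℚ, a, b]} {x : ℍ[ℚ, a, b]} (hx : x ∈ L) :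
    (n : ℚ) • x ∈ scalar a b n * L :=
  mem_scalar_mul.2 ⟨x, hx, rfl⟩

theorem mul_scalar (n : ℕ) (L : Submodule ℤ ℍ[ℚ, a, b]) :
    L * scalar a b n = scalar a b n * L := by
  ext x
  rw [scalar, Submodule.mem_span_singleton_mul, Submodule.mem_mul_span_singleton]
  simp [Nat.cast_comm]

theorem mul_scalar_mul (n : ℕ) (L M : Submodule ℤ ℍ[ℚ, a, b]) :
    L * (scalar a b n * M) = scalar a b n * (L * M) := by
  rw [← mul_assoc, mul_scalar, mul_assoc]

theorem conj_scalar_mul (n : ℕ) (L : Submodule ℤ ℍ[ℚ, a, b]) :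
    conj (scalar a b n * L) = scalar a b n * conj L := by
  ext x
  simp only [mem_conj, mem_scalar_mul]
  constructor
  · rintro ⟨y, hy, h⟩
    refine ⟨star y, by simpa using hy, ?_⟩
    rw [← star_star x, ← h]
    simp
  · rintro ⟨y, hy, rfl⟩
    exact ⟨star y, hy, by simp⟩

theorem relIndex_conj (L M : Submodule ℤ ℍ[ℚ, a, b]) :
    (conj L).toAddSubgroup.relIndex (conj M).toAddSubgroup =
      L.toAddSubgroup.relIndex M.toAddSubgroup :=
  AddSubgroup.relIndex_map_map_of_injective L.toAddSubgroup M.toAddSubgroup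
    (f := (starAddEquiv (R := ℍ[ℚ, a, b])).toAddMonoidHom) star_injective

theorem relIndex_scalar_mul {n : ℕ} {L : Submodule ℤ ℍ[ℚ, a, b]} (hL : IsIdeal L.toAddSubgroup) :
    (scalar a b n * L).toAddSubgroup.relIndex L.toAddSubgroup = n ^ 4 := by
  have : Submodule.IsLattice ℚ L := ⟨(isIdeal_iff.1 hL).1, (isIdeal_iff.1 hL).2⟩
  have := Submodule.IsLattice.free ℚ L
  have hr : Module.finrank ℤ L = 4 :=
    (Module.finrank_eq_of_rank_eq ((Submodule.IsLattice.rank' ℚ L).trans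
      (by rw [QuaternionAlgebra.rank_eq_four]; rfl)))
  rw [← hr, ← AddSubgroup.index_range_nsmul, AddSubgroup.relIndex]
  congr 1
  ext x
  rw [AddSubgroup.mem_addSubgroupOf]
  change (x : ℍ[ℚ, a, b]) ∈ scalar a b n * L ↔ _
  rw [mem_scalar_mul]
  constructor
  · rintro ⟨y, hy, h⟩
    refine ⟨⟨y, hy⟩, Subtype.ext ?_⟩
    rw [← h, Nat.cast_smul_eq_nsmul]
    rfl
  · rintro ⟨y, rfl⟩
    exact ⟨y, y.2, by rw [Nat.cast_smul_eq_nsmul]; rfl⟩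

end ScaleConj

/-! ### Index inequalities from pairings. -/

section Pairing

/-- The pairing embeds `X / X₀` in the character group of the finite group `Y / Y₀`, which has as
many elements as `Y / Y₀`. Only nondegeneracy on the `X` side is needed. -/
theorem index_le_of_pairing {X Y : Type*} [AddCommGroup X] [AddCommGroup Y]
    (X₀ : AddSubgroup X) (Y₀ : AddSubgroup Y) (f : X →+ Y →+ AddCircle (1 : ℝ))
    (hY : Y₀.index ≠ 0) (h₀ : ∀ x, ∀ y ∈ Y₀, f x y = 0)
    (hX : ∀ x, (∀ y, f x y = 0) → x ∈ X₀) : X₀.index ≤ Y₀.index := by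
  have : Y₀.FiniteIndex := ⟨hY⟩
  have : Fintype (Y ⧸ Y₀) := Fintype.ofFinite _
  let c (x : X) : AddChar (Y ⧸ Y₀) ℂ :=
    { toFun := fun q => (AddCircle.toCircle (QuotientAddGroup.lift Y₀ (f x) (h₀ x) q) : ℂ)
      map_zero_eq_one' := by simp
      map_add_eq_mul' := fun p q => by simp [AddCircle.toCircle_add] }
  have hc (x x' : X) (h : c x = c x') : x - x' ∈ X₀ := by
    apply hX
    intro y
    have h1 := DFunLike.congr_fun h (y : Y ⧸ Y₀)
    have h2 : f x y = f x' y :=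
      AddCircle.injective_toCircle one_ne_zero (Subtype.coe_injective h1)
    rw [map_sub, AddMonoidHom.sub_apply, h2, sub_self]
  have hinj : Function.Injective fun q : X ⧸ X₀ => c q.out := by
    intro q q' h
    have h1 := hc _ _ h
    rw [← QuotientAddGroup.out_eq' q, ← QuotientAddGroup.out_eq' q', QuotientAddGroup.eq]
    have h2 := X₀.neg_mem h1
    rwa [neg_sub, sub_eq_neg_add] at h2
  calc X₀.index = Nat.card (X ⧸ X₀) := rfl
    _ ≤ Nat.card (AddChar (Y ⧸ Y₀) ℂ) := Nat.card_le_card_of_injective _ hinj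
    _ = Nat.card (Y ⧸ Y₀) := by
      rw [Nat.card_eq_fintype_card, AddChar.card_eq, Nat.card_eq_fintype_card]
    _ = Y₀.index := rfl

variable {a b : ℚ}

theorem relIndex_le_of_trd_pairing {m : ℕ} (hm : 0 < m) {X₀ X Y₀ Y : AddSubgroup ℍ[ℚ, a, b]}
    (hY : Y₀.relIndex Y ≠ 0) (h₀ : ∀ x ∈ X, ∀ y ∈ Y₀, ∃ k : ℤ, trd (x * y) = m * k)
    (hX : ∀ x ∈ X, (∀ y ∈ Y, ∃ k : ℤ, trd (x * y) = m * k) → x ∈ X₀) :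
    X₀.relIndex X ≤ Y₀.relIndex Y := by
  have hm' : (m : ℚ) ≠ 0 := by positivity
  -- The class of `trd z / m` modulo 1, which vanishes exactly when `trd z ∈ m ℤ`.
  let T : ℍ[ℚ, a, b] →+ AddCircle (1 : ℝ) :=
    (QuotientAddGroup.mk' (AddSubgroup.zmultiples (1 : ℝ))).comp
      ((Rat.castHom ℝ).toAddMonoidHom.comp ((AddMonoidHom.mulLeft ((m : ℚ)⁻¹)).comp
        (trdHom (a := a) (b := b)).toAddMonoidHom))
  have hT (z : ℍ[ℚ, a, b]) : T z = 0 ↔ ∃ k : ℤ, trd z = m * k := by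
    have h1 : T z = (((m : ℚ)⁻¹ * trd z : ℚ) : ℝ) := rfl
    rw [h1, AddCircle.coe_eq_zero_iff]
    refine exists_congr fun k => ?_
    rw [zsmul_eq_mul, mul_one, ← inv_mul_eq_iff_eq_mul₀ hm', eq_comm]
    constructor
    · intro h; exact_mod_cast h
    · intro h; exact_mod_cast h
  let f : X →+ Y →+ AddCircle (1 : ℝ) :=
    (((AddMonoidHom.mul (R := ℍ[ℚ, a, b])).compr₂ T).comp X.subtype).compl₂ Y.subtype
  have hf (x : X) (y : Y) : f x y = T (x * y) := rfl
  refine index_le_of_pairing (X₀.addSubgroupOf X) (Y₀.addSubgroupOf Y) f hY ?_ ?_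
  · intro x y hy
    rw [hf, hT]
    exact h₀ x x.2 y hy
  · intro x hx
    refine hX x x.2 fun y hy => ?_
    rw [← hT]
    exact hx ⟨y, hy⟩

end Pairing

/-! ### The distance, the lattice `m O O'` and the index of the intersection. -/

section Distance

variable {a b : ℚ} {O O' : Submodule ℤ ℍ[ℚ, a, b]} {m : ℕ}

theorem IsMaximalOrder.fg (hO : IsMaximalOrder O.toAddSubgroup) : O.FG := (isIdeal_iff.1 hO.1.1).1

theorem IsMaximalOrder.one_mem (hO : IsMaximalOrder O.toAddSubgroup) : 1 ∈ O := hO.1.2.1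

/-- The reduced norms on `O O'` generate the group `(1 / m) ℤ`. -/
structure IsDistance (O O' : Submodule ℤ ℍ[ℚ, a, b]) (m : ℕ) : Prop where
  left_maximal : IsMaximalOrder O.toAddSubgroup
  right_maximal : IsMaximalOrder O'.toAddSubgroup
  pos : 0 < m
  nrd_eq : ∀ x ∈ O * O', ∃ k : ℤ, nrd x = (m : ℚ)⁻¹ * k
  inv_mem : (m : ℚ)⁻¹ ∈ AddSubgroup.closure (nrd '' (↑(O * O') : Set ℍ[ℚ, a, b]))

/-- The norms generate a cyclic group; it contains `nrd 1 = 1`, so its generator is the inverse of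
an integer. -/
theorem exists_isDistance (hO : IsMaximalOrder O.toAddSubgroup)
    (hO' : IsMaximalOrder O'.toAddSubgroup) : ∃ m, IsDistance O O' m := by
  obtain ⟨g, hg⟩ := exists_closure_nrd_eq_zmultiples (hO.fg.mul hO'.fg)
  have h1 : (1 : ℚ) ∈ AddSubgroup.zmultiples g := by
    rw [← hg]
    refine AddSubgroup.subset_closure ⟨1, ?_, nrd_one⟩
    simpa using Submodule.mul_mem_mul hO.one_mem hO'.one_mem
  obtain ⟨k, hk⟩ := AddSubgroup.mem_zmultiples_iff.1 h1
  rw [zsmul_eq_mul] at hk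
  have hk0 : k ≠ 0 := by rintro rfl; simp at hk
  have hg' : AddSubgroup.zmultiples g = AddSubgroup.zmultiples ((k.natAbs : ℚ)⁻¹) := by
    have h2 : g = (k : ℚ)⁻¹ := eq_inv_of_mul_eq_one_right hk
    rw [Nat.cast_natAbs, h2, Int.cast_abs]
    rcases abs_choice (k : ℚ) with h | h
    · rw [h]
    · rw [h, inv_neg, AddSubgroup.zmultiples_neg]
  refine ⟨k.natAbs, hO, hO', Int.natAbs_pos.2 hk0, fun x hx => ?_, ?_⟩
  · have h2 : nrd x ∈ AddSubgroup.zmultiples ((k.natAbs : ℚ)⁻¹) := by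
      rw [← hg', ← hg]
      exact AddSubgroup.subset_closure ⟨x, hx, rfl⟩
    obtain ⟨l, hl⟩ := AddSubgroup.mem_zmultiples_iff.1 h2
    exact ⟨l, by rw [← hl, zsmul_eq_mul, mul_comm]⟩
  · rw [hg, hg']
    exact AddSubgroup.mem_zmultiples _

namespace IsDistance

theorem conj_mul_eq (h : IsDistance O O' m) : conj (O * O') = O' * O := by
  rw [conj_mul, h.left_maximal.1.conj_eq, h.right_maximal.1.conj_eq]

theorem symm (h : IsDistance O O' m) : IsDistance O' O m := by
  refine ⟨h.right_maximal, h.left_maximal, h.pos, fun x hx => ?_, ?_⟩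
  · rw [← h.conj_mul_eq, mem_conj] at hx
    rw [← nrd_star]
    exact h.nrd_eq _ hx
  · have h1 := h.inv_mem
    convert h1 using 2
    ext q
    constructor
    · rintro ⟨x, hx, rfl⟩
      rw [← h.conj_mul_eq] at hx
      exact ⟨star x, mem_conj.1 hx, nrd_star x⟩
    · rintro ⟨x, hx, rfl⟩
      exact ⟨star x, by rw [← h.conj_mul_eq]; exact star_mem_conj hx, nrd_star x⟩

/-- A closure argument: what holds for all norms on `O O'` holds for `1 / m`. -/
theorem inv_induction (h : IsDistance O O' m) (G : AddSubgroup ℚ)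
    (hG : ∀ x ∈ O * O', nrd x ∈ G) : (m : ℚ)⁻¹ ∈ G := by
  refine (AddSubgroup.closure_le G).2 ?_ h.inv_mem
  rintro _ ⟨x, hx, rfl⟩
  exact hG x hx

/-- Since `O O' O` is the product of `O O'` and its conjugate, `⊆` is the membership criterion with
`ν = 1/m`. For `⊇`, the left `O`-module on the left side contains `m nrd x` for each `x ∈ O O'`,
hence `m · (1/m) = 1`. -/
theorem scalar_mul_eq (h : IsDistance O O' m) : scalar a b m * (O * O' * O) = O := by
  have hm : (m : ℚ) ≠ 0 := by have := h.pos; positivity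
  have hO := h.left_maximal.1.mul_self
  have hO' := h.right_maximal.1.mul_self
  have h1 : O * O' * O = O * O' * (O' * O) := by rw [← mul_assoc, mul_assoc O O' O', hO']
  apply le_antisymm
  · intro x hx
    obtain ⟨y, hy, rfl⟩ := mem_scalar_mul.1 hx
    rw [h1] at hy
    clear hx
    induction hy using Submodule.mul_induction_on' with
    | mem_mul_mem y hy z hz =>
      rw [← h.conj_mul_eq, mem_conj] at hz
      have h2 := h.left_maximal.mul_star_mem (L := O * O') (by rw [← mul_assoc, hO])
        (inv_ne_zero hm) h.nrd_eq hy hz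
      rwa [inv_inv, star_star] at h2
    | add y _ z _ hy hz => rw [smul_add]; exact O.add_mem hy hz
  · have h2 : (1 : ℍ[ℚ, a, b]) ∈ scalar a b m * (O * O' * O) := by
      let f : ℚ →+ ℍ[ℚ, a, b] := ((AddMonoidHom.flip (smulAddHom ℚ ℍ[ℚ, a, b])) 1).comp
        (AddMonoidHom.mulLeft (m : ℚ))
      have h3 := h.inv_induction ((scalar a b m * (O * O' * O)).toAddSubgroup.comap f) ?_
      · change ((m : ℚ) * (m : ℚ)⁻¹) • (1 : ℍ[ℚ, a, b]) ∈ scalar a b m * (O * O' * O) at h3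
        rwa [mul_inv_cancel₀ hm, one_smul] at h3
      · intro x hx
        change ((m : ℚ) * nrd x) • (1 : ℍ[ℚ, a, b]) ∈ scalar a b m * (O * O' * O)
        rw [mul_smul, ← mul_star_eq_nrd_smul, h1]
        apply smul_mem_scalar_mul
        apply Submodule.mul_mem_mul hx
        rw [← h.conj_mul_eq]
        exact star_mem_conj hx
    intro x hx
    have h3 := Submodule.mul_mem_mul h2 hx
    rwa [one_mul, mul_assoc, mul_assoc (O * O'), hO] at h3

end IsDistance

/-- The primitive integral lattice linking `O` to `O'` when `m` is their distance. -/
def linking (O O' : Submodule ℤ ℍ[ℚ, a, b]) (m : ℕ) : Submodule ℤ ℍ[ℚ, a, b] :=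
  scalar a b m * (O * O')

namespace IsDistance

theorem linking_mul_left (h : IsDistance O O' m) : linking O O' m * O = O := by
  rw [linking, mul_assoc, h.scalar_mul_eq]

theorem left_mul_linking (h : IsDistance O O' m) : O * linking O O' m = linking O O' m := by
  rw [linking, mul_scalar_mul, ← mul_assoc O O, h.left_maximal.1.mul_self]

theorem linking_mul_right (h : IsDistance O O' m) : linking O O' m * O' = linking O O' m := by
  rw [linking, mul_assoc, mul_assoc O, h.right_maximal.1.mul_self]

theorem right_mul_linking (h : IsDistance O O' m) : O' * linking O O' m = O' := by
  rw [linking, mul_scalar_mul, ← mul_assoc O', h.symm.scalar_mul_eq]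

theorem conj_linking (h : IsDistance O O' m) : conj (linking O O' m) = linking O' O m := by
  rw [linking, conj_scalar_mul, h.conj_mul_eq, linking]

theorem linking_le_left (h : IsDistance O O' m) : linking O O' m ≤ O := by
  intro x hx
  rw [← h.linking_mul_left]
  simpa using Submodule.mul_mem_mul hx h.left_maximal.one_mem

theorem linking_le_right (h : IsDistance O O' m) : linking O O' m ≤ O' := by
  intro x hx
  rw [← h.right_mul_linking]
  simpa using Submodule.mul_mem_mul h.right_maximal.one_mem hx

theorem linking_mul_self (h : IsDistance O O' m) :
    linking O O' m * linking O O' m = linking O O' m := by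
  nth_rw 2 [linking]
  rw [mul_scalar_mul, ← mul_assoc (linking O O' m), h.linking_mul_left, linking]

theorem linking_mul_linking (h : IsDistance O O' m) :
    linking O O' m * linking O' O m = scalar a b m * O := by
  nth_rw 2 [linking]
  rw [mul_scalar_mul, ← mul_assoc (linking O O' m), h.linking_mul_right, h.linking_mul_left]

theorem scalar_mul_left_le (h : IsDistance O O' m) : scalar a b m * O ≤ linking O O' m := by
  intro x hx
  obtain ⟨y, hy, rfl⟩ := mem_scalar_mul.1 hx
  refine smul_mem_scalar_mul m ?_
  simpa using Submodule.mul_mem_mul hy h.right_maximal.one_mem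

theorem linking_nrd (h : IsDistance O O' m) {x : ℍ[ℚ, a, b]} (hx : x ∈ linking O O' m) :
    ∃ k : ℤ, nrd x = m * k := by
  have hm : (m : ℚ) ≠ 0 := by have := h.pos; positivity
  obtain ⟨y, hy, rfl⟩ := mem_scalar_mul.1 hx
  obtain ⟨k, hk⟩ := h.nrd_eq y hy
  exact ⟨k, by rw [nrd_smul, hk]; field_simp⟩

theorem mul_star_mem (h : IsDistance O O' m) {x y : ℍ[ℚ, a, b]} (hx : x ∈ linking O O' m)
    (hy : y ∈ linking O O' m) : x * star y ∈ scalar a b m * O := by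
  rw [← h.linking_mul_linking, ← h.conj_linking]
  exact Submodule.mul_mem_mul hx (star_mem_conj hy)

/-- The trace pairing on `O` is perfect modulo the distance. -/
theorem mem_scalar_mul_of_trd (h : IsDistance O O' m) {x : ℍ[ℚ, a, b]} (hx : x ∈ O)
    (ht : ∀ y ∈ O, ∃ k : ℤ, trd (x * y) = m * k) : x ∈ scalar a b m * O := by
  have hO := h.left_maximal.1.mul_self
  set X : Submodule ℤ ℍ[ℚ, a, b] := Submodule.span ℤ {x}
  have hX : X ≤ O := (Submodule.span_singleton_le_iff_mem x O).2 hx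
  have hW : O * X * O ≤ O := by
    calc O * X * O ≤ O * O * O := by gcongr
      _ = O := by rw [hO, hO]
  have htr : ∀ w ∈ O * X * O, ∃ k : ℤ, trd w = m * k := by
    intro w hw
    induction hw using Submodule.mul_induction_on' with
    | mem_mul_mem y hy z hz =>
      obtain ⟨u, hu, v, hv, rfl⟩ := Submodule.mem_mul_span_singleton.1 hy
      obtain ⟨k, hk⟩ := ht (z * u) (hO ▸ Submodule.mul_mem_mul hz hu)
      refine ⟨k, ?_⟩
      rw [← hk, mul_assoc, trd_mul_comm, mul_assoc]
    | add y _ z _ hy hz =>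
      obtain ⟨k, hk⟩ := hy
      obtain ⟨l, hl⟩ := hz
      exact ⟨k + l, by rw [trd_add, hk, hl]; push_cast; ring⟩
  set I := linking O O' m
  -- Expand `z y z' = trd (y z') z - z z̄' ȳ`: the trace is divisible by `m`, and `z z̄' ∈ I I' = m
  -- O`. As `I O = O`, the factors `I` are then absorbed by multiplying by `O`.
  have hI : I * (O * X * O) * I ≤ scalar a b m * O := by
    rw [Submodule.mul_le]
    intro u hu z' hz'
    induction hu using Submodule.mul_induction_on' with
    | mem_mul_mem z hz y hy =>
      have hyz : y * z' ∈ O * X * O := by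
        have := Submodule.mul_mem_mul hy (h.linking_le_left hz')
        rwa [mul_assoc _ O O, hO] at this
      obtain ⟨k, hk⟩ := htr _ hyz
      rw [mul_mul_eq_trd_smul_sub, hk]
      apply Submodule.sub_mem
      · rw [mul_smul, Int.cast_smul_eq_zsmul]
        exact smul_mem_scalar_mul m (O.smul_mem k (h.linking_le_left hz))
      · have := Submodule.mul_mem_mul (h.mul_star_mem hz hz') (h.left_maximal.1.star_mem (hW hy))
        rwa [mul_assoc, hO] at this
    | add y _ z _ hy hz => rw [add_mul]; exact Submodule.add_mem _ hy hz
  have hI' : O * X * O ≤ scalar a b m * O := by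
    calc O * X * O = I * (O * X * O) * I * O := by
          rw [mul_assoc _ I O, h.linking_mul_left, ← mul_assoc I, ← mul_assoc I,
            h.linking_mul_left, mul_assoc _ O O, hO]
      _ ≤ scalar a b m * O * O := by gcongr
      _ = scalar a b m * O := by rw [mul_assoc, hO]
  apply hI'
  have := Submodule.mul_mem_mul (Submodule.mul_mem_mul h.left_maximal.one_mem
    (Submodule.mem_span_singleton_self (R := ℤ) x)) h.left_maximal.one_mem
  simpa using this

/-- Conjugation gives `[I : mO] = [I' : mO]`, and `[O : I] = [I' : mO]` follows from the pairing
`trd (x y)` modulo `m` between `O / I` and `I' / mO`, used in both directions. The product of the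
two equal indices is `[O : mO] = m⁴`. -/
theorem relIndex_linking (h : IsDistance O O' m) :
    (linking O O' m).toAddSubgroup.relIndex O.toAddSubgroup = m ^ 2 := by
  have hO := h.left_maximal.1.mul_self
  set D := scalar a b m
  set I := linking O O' m with hI
  set I' := linking O' O m with hI'
  have hDO : (D * O).toAddSubgroup.relIndex O.toAddSubgroup = m ^ 4 :=
    relIndex_scalar_mul h.left_maximal.1.1
  have hDI : D * O ≤ I := h.scalar_mul_left_le
  have hI_left : I ≤ O := h.linking_le_left
  have hDI' : D * O ≤ I' := by
    have := conj_mono hDI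
    rwa [conj_scalar_mul, h.left_maximal.1.conj_eq, h.conj_linking] at this
  have hI'_left : I' ≤ O := h.symm.linking_le_right
  have hmul : (D * O).toAddSubgroup.relIndex I.toAddSubgroup *
      I.toAddSubgroup.relIndex O.toAddSubgroup = m ^ 4 := by
    rw [AddSubgroup.relIndex_mul_relIndex _ _ _ hDI hI_left, hDO]
  have hconj : (D * O).toAddSubgroup.relIndex I'.toAddSubgroup =
      (D * O).toAddSubgroup.relIndex I.toAddSubgroup := by
    rw [← relIndex_conj (D * O) I, conj_scalar_mul, h.left_maximal.1.conj_eq, h.conj_linking]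
  have hm4 : m ^ 4 ≠ 0 := (pow_pos h.pos 4).ne'
  have hDtrd : ∀ x ∈ D * O, ∃ k : ℤ, trd x = m * k := by
    intro x hx
    obtain ⟨y, hy, rfl⟩ := mem_scalar_mul.1 hx
    obtain ⟨k, hk⟩ := h.left_maximal.1.exists_trd_eq hy
    exact ⟨k, by rw [trd_smul, hk]⟩
  have hI'_mul : I' * O = I' := h.symm.linking_mul_right
  have hII' : I * I' = D * O := h.linking_mul_linking
  have hI'I : I' * I = D * O' := h.symm.linking_mul_linking
  have hle : I.toAddSubgroup.relIndex O.toAddSubgroup ≤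
      (D * O).toAddSubgroup.relIndex I'.toAddSubgroup := by
    apply relIndex_le_of_trd_pairing h.pos
    · rw [hconj]
      exact left_ne_zero_of_mul (hmul ▸ hm4)
    · intro x hx y hy
      apply hDtrd
      have := Submodule.mul_mem_mul (show x ∈ O from hx) (show y ∈ D * O from hy)
      rwa [mul_scalar_mul, hO] at this
    · intro x hx hxy
      have h1 : ∀ z ∈ I', x * z ∈ D * O := by
        intro z hz
        apply h.mem_scalar_mul_of_trd
        · rw [← hO]; exact Submodule.mul_mem_mul hx (hI'_left hz)
        · intro y hy
          rw [mul_assoc]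
          exact hxy _ (show z * y ∈ I' from hI'_mul ▸ Submodule.mul_mem_mul hz hy)
      have h2 : Submodule.span ℤ {x} * I' ≤ D * O := by
        intro w hw
        obtain ⟨z, hz, rfl⟩ := Submodule.mem_span_singleton_mul.1 hw
        exact h1 z hz
      -- Multiply `x I' ⊆ m O` by `I` on the right and use `I' I = m O'`; cancelling `m` then puts
      -- `x` in `I`.
      have h3 : D * (Submodule.span ℤ {x} * O') ≤ D * I := by
        calc D * (Submodule.span ℤ {x} * O') = Submodule.span ℤ {x} * I' * I := by
              rw [mul_assoc, hI'I, mul_scalar_mul]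
          _ ≤ D * O * I := by gcongr
          _ = D * I := by rw [mul_assoc, h.left_mul_linking]
      have h4 : (m : ℚ) • x ∈ D * I := by
        apply h3
        apply smul_mem_scalar_mul
        simpa using Submodule.mul_mem_mul (Submodule.mem_span_singleton_self (R := ℤ) x)
          h.right_maximal.one_mem
      have hm : (m : ℚ) ≠ 0 := by have := h.pos; positivity
      have h5 := (mem_scalar_mul_iff h.pos).1 h4
      rwa [inv_smul_smul₀ hm] at h5
  have hge : (D * O).toAddSubgroup.relIndex I'.toAddSubgroup ≤
      I.toAddSubgroup.relIndex O.toAddSubgroup := by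
    apply relIndex_le_of_trd_pairing h.pos
    · exact right_ne_zero_of_mul (hmul ▸ hm4)
    · intro x hx y hy
      rw [trd_mul_comm]
      apply hDtrd
      rw [← hII']
      exact Submodule.mul_mem_mul hy hx
    · intro x hx hxy
      exact h.mem_scalar_mul_of_trd (hI'_left hx) hxy
  have heq := le_antisymm hle hge
  rw [← hconj, ← heq] at hmul
  have h6 : (I.toAddSubgroup.relIndex O.toAddSubgroup) ^ 2 = (m ^ 2) ^ 2 := by
    rw [sq, hmul]; ring
  exact Nat.pow_left_injective (two_ne_zero) h6

/-- If the traces of `O` and `m` generate `d ℤ` and `m = d c`, then `c` pairs `O` into `m ℤ`, so `c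
= m z` with `z ∈ O`. Taking norms gives `d² nrd z = 1`, so `d` is a unit. -/
theorem exists_trd_eq_one_sub (h : IsDistance O O' m) :
    ∃ y ∈ O, ∃ k : ℤ, trd y = 1 - m * k := by
  let A : AddSubgroup ℤ := ((O.toAddSubgroup.map
    (trdHom (a := a) (b := b)).toAddMonoidHom).comap (Int.castAddHom ℚ)) ⊔
      AddSubgroup.zmultiples (m : ℤ)
  obtain ⟨d, hd⟩ := Int.subgroup_cyclic A
  rw [← AddSubgroup.zmultiples_eq_closure] at hd
  have hmA : (m : ℤ) ∈ A := AddSubgroup.mem_sup_right (AddSubgroup.mem_zmultiples _)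
  rw [hd] at hmA
  obtain ⟨c, hc⟩ := Int.mem_zmultiples_iff.1 hmA
  have hc0 : c ≠ 0 := by
    rintro rfl
    have := h.pos
    simp at hc
    omega
  have h1 : ((c : ℚ) • 1 : ℍ[ℚ, a, b]) ∈ O := by
    rw [Int.cast_smul_eq_zsmul]; exact O.smul_mem c h.left_maximal.one_mem
  have h2 : ((c : ℚ) • 1 : ℍ[ℚ, a, b]) ∈ scalar a b m * O := by
    apply h.mem_scalar_mul_of_trd h1
    intro y hy
    obtain ⟨k, hk⟩ := h.left_maximal.1.exists_trd_eq hy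
    have hkA : k ∈ A := AddSubgroup.mem_sup_left ⟨y, hy, hk⟩
    rw [hd] at hkA
    obtain ⟨l, rfl⟩ := Int.mem_zmultiples_iff.1 hkA
    refine ⟨l, ?_⟩
    rw [smul_mul_assoc, one_mul, trd_smul, hk]
    have hc' : (m : ℚ) = d * c := by exact_mod_cast hc
    rw [hc']
    push_cast
    ring
  obtain ⟨z, hz, hzc⟩ := mem_scalar_mul.1 h2
  obtain ⟨n, hn⟩ := h.left_maximal.1.exists_nrd_eq hz
  have h3 := congrArg nrd hzc
  rw [nrd_smul, nrd_smul, nrd_one, mul_one, hn] at h3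
  have hdn : d * (d * n) = 1 := by
    have h4 : ((m : ℤ) ^ 2 * n : ℤ) = c ^ 2 := by exact_mod_cast h3
    rw [hc] at h4
    have h5 : c ^ 2 * (d * (d * n)) = c ^ 2 * 1 := by linear_combination h4
    exact mul_left_cancel₀ (pow_ne_zero 2 hc0) h5
  have h1A : (1 : ℤ) ∈ A := by
    rw [hd, Int.mem_zmultiples_iff]
    exact ⟨_, hdn.symm⟩
  obtain ⟨t, ht, u, hu, htu⟩ := AddSubgroup.mem_sup.1 h1A
  obtain ⟨y, hy, hyt⟩ := ht
  obtain ⟨k, rfl⟩ := Int.mem_zmultiples_iff.1 hu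
  refine ⟨y, hy, k, ?_⟩
  have h6 : trd y = (t : ℚ) := hyt
  rw [h6, eq_sub_iff_add_eq]
  exact_mod_cast htu

/-- As `trd (u v) = trd (v u)` and `O I = I`, every trace on `I O = O` is already a trace on `I`.
The resulting `e` is idempotent modulo `m`, because `nrd e ∈ m ℤ`. -/
theorem exists_mem_linking_trd (h : IsDistance O O' m) :
    ∃ e ∈ linking O O' m, ∃ k : ℤ, trd e = 1 - m * k := by
  obtain ⟨y, hy, k, hk⟩ := h.exists_trd_eq_one_sub
  have key : ∀ w ∈ linking O O' m * O, ∃ v ∈ linking O O' m, trd v = trd w := by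
    intro w hw
    induction hw using Submodule.mul_induction_on' with
    | mem_mul_mem u hu v hv =>
      refine ⟨v * u, ?_, trd_mul_comm v u⟩
      rw [← h.left_mul_linking]
      exact Submodule.mul_mem_mul hv hu
    | add x _ z _ hx hz =>
      obtain ⟨v, hv, hvx⟩ := hx
      obtain ⟨w, hw, hwz⟩ := hz
      exact ⟨v + w, Submodule.add_mem _ hv hw, by rw [trd_add, trd_add, hvx, hwz]⟩
  obtain ⟨e, he, het⟩ := key y (by rwa [h.linking_mul_left])
  exact ⟨e, he, k, het.trans hk⟩

/-- Modulo `m O`, `ē ≡ 1 - e`, so `x ≡ x e + e x ē + ē x ē`. Here `x e ∈ O I = I`, `e x ē ∈ I O' I'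
= m O`, and `ē x ē ≡ k ē ≡ k - k e` with `k = trd (x ē)`. -/
theorem exists_sub_smul_one_mem (h : IsDistance O O' m) {x : ℍ[ℚ, a, b]} (hx : x ∈ O)
    (hx' : x ∈ O') : ∃ k : ℤ, x - k • 1 ∈ linking O O' m := by
  obtain ⟨e, he, c, hc⟩ := h.exists_mem_linking_trd
  have hO := h.left_maximal.1
  set I := linking O O' m
  have hDI : scalar a b m * O ≤ I := h.scalar_mul_left_le
  have hmO {y : ℍ[ℚ, a, b]} (hy : y ∈ O) (l : ℤ) : ((m : ℚ) * l) • y ∈ I := by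
    rw [mul_smul, Int.cast_smul_eq_zsmul]
    exact hDI (smul_mem_scalar_mul m (O.smul_mem l hy))
  have heO : e ∈ O := h.linking_le_left he
  have hxe : x * star e ∈ O := hO.2.2 _ hx _ (hO.star_mem heO)
  obtain ⟨k, hk⟩ := hO.exists_trd_eq hxe
  obtain ⟨n, hn⟩ := h.linking_nrd he
  refine ⟨k, ?_⟩
  have h1 : x * e ∈ I := h.left_mul_linking.le (Submodule.mul_mem_mul hx he)
  have h2 : e * (x * star e) ∈ I := by
    apply hDI
    rw [← h.linking_mul_linking]
    apply Submodule.mul_mem_mul he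
    rw [← h.symm.left_mul_linking]
    apply Submodule.mul_mem_mul hx'
    rw [← h.conj_linking]
    exact star_mem_conj he
  have h3 : star e = (1 - (m : ℚ) * c) • 1 - e := by rw [star_eq_trd_smul_sub, hc]
  have h4 : star e * x * star e = (k : ℚ) • star e - ((m : ℚ) * n) • star x := by
    rw [mul_mul_eq_trd_smul_sub, hk, star_star, star_mul_eq_nrd_smul, hn, smul_mul_assoc, one_mul]
  have h5 : star e * x * star e = (1 - (m : ℚ) * c) • (x * star e) - e * (x * star e) := by
    nth_rw 1 [h3]
    rw [sub_mul, sub_mul, smul_mul_assoc, smul_mul_assoc, one_mul, mul_assoc]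
  have h6 : x * star e = (1 - (m : ℚ) * c) • x - x * e := by
    rw [h3, mul_sub, mul_smul_comm, mul_one]
  have h7 : x - k • (1 : ℍ[ℚ, a, b]) = x * e + ((m : ℚ) * c) • x + ((m : ℚ) * c) • (x * star e)
      + e * (x * star e) - ((m : ℚ) * n) • star x - k • e - ((m : ℚ) * (k * c : ℤ)) • 1 := by
    have h8 : x * star e = ((m : ℚ) * c) • (x * star e) + e * (x * star e) +
        ((k : ℚ) • ((1 - (m : ℚ) * c) • 1 - e) - ((m : ℚ) * n) • star x) := by
      rw [← h3, ← h4, h5]; module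
    have h9 : x = x * e + ((m : ℚ) * c) • x + x * star e := by rw [h6]; module
    simp only [← Int.cast_smul_eq_zsmul ℚ]
    nth_rw 1 [h9, h8]
    push_cast
    module
  rw [h7]
  exact I.sub_mem (I.sub_mem (I.sub_mem (I.add_mem (I.add_mem (I.add_mem h1 (hmO hx c))
    (hmO hxe c)) h2) (hmO (hO.star_mem hx) n)) (I.smul_mem k he)) (hmO hO.2.1 _)

/-- If `k ∈ I`, then `k ē ∈ I I' = m O`, whose trace is `k` modulo `m`. -/
theorem dvd_of_smul_one_mem (h : IsDistance O O' m) {k : ℤ}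
    (hk : k • (1 : ℍ[ℚ, a, b]) ∈ linking O O' m) : (m : ℤ) ∣ k := by
  obtain ⟨e, he, c, hc⟩ := h.exists_mem_linking_trd
  obtain ⟨y, hy, hye⟩ := mem_scalar_mul.1 (h.mul_star_mem hk he)
  obtain ⟨n, hn⟩ := h.left_maximal.1.exists_trd_eq hy
  have h1 := congrArg trd hye
  rw [← Int.cast_smul_eq_zsmul ℚ, smul_mul_assoc, one_mul, trd_smul, trd_smul, trd_star, hn,
    hc] at h1
  have h2 : (m : ℤ) * n = k * (1 - m * c) := by exact_mod_cast h1
  exact ⟨n + k * c, by linear_combination -h2⟩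

theorem relIndex_inf (h : IsDistance O O' m) :
    (O.toAddSubgroup ⊓ O'.toAddSubgroup).relIndex O.toAddSubgroup = m := by
  set I := linking O O' m
  let f : ℤ →+ ℍ[ℚ, a, b] := (smulAddHom ℤ ℍ[ℚ, a, b]).flip 1
  have hf (k : ℤ) : f k = k • 1 := rfl
  have h1 : O.toAddSubgroup ⊓ O'.toAddSubgroup = f.range ⊔ I.toAddSubgroup := by
    apply le_antisymm
    · rintro x ⟨hx, hx'⟩
      obtain ⟨k, hk⟩ := h.exists_sub_smul_one_mem hx hx'
      exact AddSubgroup.mem_sup.2 ⟨f k, ⟨k, rfl⟩, _, hk, by rw [hf]; abel⟩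
    · apply sup_le
      · rintro _ ⟨k, rfl⟩
        exact ⟨O.smul_mem k h.left_maximal.one_mem, O'.smul_mem k h.right_maximal.one_mem⟩
      · exact le_inf h.linking_le_left h.linking_le_right
  have h2 : I.toAddSubgroup.comap f = AddSubgroup.zmultiples (m : ℤ) := by
    ext k
    rw [Int.mem_zmultiples_iff, AddSubgroup.mem_comap, hf]
    refine ⟨h.dvd_of_smul_one_mem, ?_⟩
    rintro ⟨c, rfl⟩
    apply h.scalar_mul_left_le
    have := smul_mem_scalar_mul m (O.smul_mem c h.left_maximal.one_mem)
    rwa [Nat.cast_smul_eq_nsmul, ← natCast_zsmul, smul_smul] at this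
  have h3 : I.toAddSubgroup.relIndex (O.toAddSubgroup ⊓ O'.toAddSubgroup) = m := by
    rw [h1, AddSubgroup.relIndex_sup_right, ← AddSubgroup.index_comap, h2, Int.index_zmultiples]
    simp
  have h4 := AddSubgroup.relIndex_mul_relIndex I.toAddSubgroup
    (O.toAddSubgroup ⊓ O'.toAddSubgroup) O.toAddSubgroup
    (le_inf h.linking_le_left h.linking_le_right) inf_le_left
  rw [h3, h.relIndex_linking, sq] at h4
  exact Nat.eq_of_mul_eq_mul_left h.pos h4

end IsDistance

end Distance

/-! ### Linking ideals and the minimality of the distance. -/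

section Linking

variable {a b : ℚ} {O O' L : Submodule ℤ ℍ[ℚ, a, b]} {m : ℕ}

theorem fg_of_smul_mem (hL : L.FG) {M : Submodule ℤ ℍ[ℚ, a, b]} {n : ℕ} (hn : 0 < n)
    (h : ∀ x ∈ M, (n : ℚ) • x ∈ L) : M.FG := by
  have hn' : (n : ℚ) ≠ 0 := by positivity
  let f : ℍ[ℚ, a, b] →ₗ[ℤ] ℍ[ℚ, a, b] := (LinearMap.lsmul ℚ ℍ[ℚ, a, b] (n : ℚ)).restrictScalars ℤ
  have hf : Function.Injective f := fun x y hxy => smul_right_injective _ hn' hxy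
  have : IsNoetherian ℤ L := isNoetherian_of_fg_of_noetherian L hL
  have hle : M.map f ≤ L := by
    rintro _ ⟨x, hx, rfl⟩
    exact h x hx
  have h1 : (M.map f).FG := (isNoetherian_submodule.1 this) _ hle
  exact Submodule.fg_of_fg_map_injective f hf h1

/-- The left order of a lattice is itself an order, so maximality forces equality. It is finitely
generated because, for `n · 1 ∈ L`, multiplication by `n` sends it into `L`. -/
theorem leftOrder_eq (hO : IsMaximalOrder O.toAddSubgroup) (hL : IsIdeal L.toAddSubgroup)
    (h : O * L ≤ L) : leftOrder L.toAddSubgroup = O.toAddSubgroup := by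
  have hle : O ≤ AddSubgroup.toIntSubmodule (leftOrder L.toAddSubgroup) :=
    fun x hx y hy => h (Submodule.mul_mem_mul hx hy)
  obtain ⟨n, hn, hnL⟩ := exists_smul_mem_of_span_eq_top (isIdeal_iff.1 hL).2 1
  refine le_antisymm (hO.2 ⟨hO.1.1.of_le hle (fg_of_smul_mem (isIdeal_iff.1 hL).1 hn ?_), ?_, ?_⟩ hle)
    hle
  · intro x hx
    have := hx _ hnL
    rwa [mul_smul_comm, mul_one] at this
  · exact hle hO.one_mem
  · intro x hx y hy z hz
    rw [mul_assoc]
    exact hx _ (hy _ hz)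

theorem rightOrder_eq (hO : IsMaximalOrder O.toAddSubgroup) (hL : IsIdeal L.toAddSubgroup)
    (h : L * O ≤ L) : rightOrder L.toAddSubgroup = O.toAddSubgroup := by
  have hle : O ≤ AddSubgroup.toIntSubmodule (rightOrder L.toAddSubgroup) :=
    fun x hx y hy => h (Submodule.mul_mem_mul hy hx)
  obtain ⟨n, hn, hnL⟩ := exists_smul_mem_of_span_eq_top (isIdeal_iff.1 hL).2 1
  refine le_antisymm (hO.2 ⟨hO.1.1.of_le hle (fg_of_smul_mem (isIdeal_iff.1 hL).1 hn ?_), ?_, ?_⟩ hle)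
    hle
  · intro x hx
    have := hx _ hnL
    rwa [smul_mul_assoc, one_mul] at this
  · exact hle hO.one_mem
  · intro x hx y hy z hz
    rw [← mul_assoc]
    exact hy _ (hx _ hz)

namespace IsDistance

theorem isIdeal_linking (h : IsDistance O O' m) : IsIdeal (linking O O' m).toAddSubgroup := by
  have h1 : IsIdeal (scalar a b m * O).toAddSubgroup := by
    rw [isIdeal_iff]
    refine ⟨(Submodule.fg_span_singleton _).mul h.left_maximal.fg, top_unique ?_⟩
    rw [← (isIdeal_iff.1 h.left_maximal.1.1).2, Submodule.span_le]
    intro x hx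
    have hm : (m : ℚ) ≠ 0 := by have := h.pos; positivity
    rw [← inv_smul_smul₀ hm x]
    exact Submodule.smul_mem _ _ (Submodule.subset_span (smul_mem_scalar_mul m hx))
  exact h1.of_le h.scalar_mul_left_le
    ((Submodule.fg_span_singleton _).mul (h.left_maximal.fg.mul h.right_maximal.fg))

theorem links_linking (h : IsDistance O O' m) :
    Links (linking O O' m).toAddSubgroup O.toAddSubgroup O'.toAddSubgroup :=
  ⟨leftOrder_eq h.left_maximal h.isIdeal_linking h.left_mul_linking.le,
    rightOrder_eq h.right_maximal h.isIdeal_linking h.linking_mul_right.le⟩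

theorem isReducedNorm_linking (h : IsDistance O O' m) :
    IsReducedNorm (linking O O' m).toAddSubgroup m := by
  refine ⟨fun x hx => h.linking_nrd hx, fun n hn => ?_⟩
  have hm : (m : ℚ) ≠ 0 := by have := h.pos; positivity
  have h1 := h.inv_induction ((AddSubgroup.zmultiples (n : ℚ)).comap
    (AddMonoidHom.mulLeft ((m : ℚ) ^ 2))) fun x hx => by
      obtain ⟨k, hk⟩ := hn _ (smul_mem_scalar_mul m hx)
      rw [nrd_smul] at hk
      exact AddSubgroup.mem_zmultiples_iff.2 ⟨k, by rw [zsmul_eq_mul, mul_comm]; exact hk.symm⟩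
  obtain ⟨k, hk⟩ := AddSubgroup.mem_zmultiples_iff.1 h1
  have hk' : (k : ℚ) * n = m := by
    rw [← zsmul_eq_mul, hk, AddMonoidHom.coe_mulLeft]
    field_simp
  have h2 : (n : ℤ) ∣ m := ⟨k, by rw [mul_comm]; exact_mod_cast hk'.symm⟩
  exact_mod_cast h2

end IsDistance

theorem IsReducedNorm.ne_zero {n : ℕ} (hL : IsIdeal L.toAddSubgroup)
    (hn : IsReducedNorm L.toAddSubgroup n) : n ≠ 0 := by
  rintro rfl
  obtain ⟨N, hN, hNL⟩ := exists_smul_mem_of_span_eq_top (isIdeal_iff.1 hL).2 1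
  obtain ⟨k, hk⟩ := hn.1 _ hNL
  rw [nrd_smul, nrd_one, Nat.cast_zero, zero_mul, mul_one] at hk
  exact (pow_ne_zero 2 (Nat.cast_ne_zero.2 hN.ne')) hk

/-- The norms generate `c n ℤ` for some integer `c`; then `n |c|` divides all norms, and the gcd
property forces `c = ±1`. -/
theorem IsReducedNorm.mem_closure {n : ℕ} (hL : IsIdeal L.toAddSubgroup)
    (hn : IsReducedNorm L.toAddSubgroup n) :
    (n : ℚ) ∈ AddSubgroup.closure (nrd '' (L : Set ℍ[ℚ, a, b])) := by
  have hn0 : (n : ℚ) ≠ 0 := Nat.cast_ne_zero.2 (hn.ne_zero hL)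
  obtain ⟨g, hg⟩ := exists_closure_nrd_eq_zmultiples (isIdeal_iff.1 hL).1
  have h1 : g ∈ AddSubgroup.zmultiples (n : ℚ) := by
    have h2 : g ∈ AddSubgroup.closure (nrd '' (L : Set ℍ[ℚ, a, b])) :=
      hg ▸ AddSubgroup.mem_zmultiples g
    refine (AddSubgroup.closure_le _).2 ?_ h2
    rintro _ ⟨x, hx, rfl⟩
    obtain ⟨k, hk⟩ := hn.1 x hx
    exact AddSubgroup.mem_zmultiples_iff.2 ⟨k, by rw [zsmul_eq_mul, mul_comm]; exact hk.symm⟩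
  obtain ⟨c, rfl⟩ := AddSubgroup.mem_zmultiples_iff.1 h1
  have h2 : n * c.natAbs ∣ n := by
    apply hn.2
    intro x hx
    have h3 : nrd x ∈ AddSubgroup.zmultiples (c • (n : ℚ)) :=
      hg ▸ AddSubgroup.subset_closure ⟨x, hx, rfl⟩
    obtain ⟨k, hk⟩ := AddSubgroup.mem_zmultiples_iff.1 h3
    obtain ⟨s, hs⟩ : ∃ s : ℤ, c = c.natAbs * s := 
      ⟨c.sign, by rw [mul_comm, Int.sign_mul_natAbs]⟩
    refine ⟨s * k, ?_⟩
    have hs' : (c : ℚ) = c.natAbs * s := by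
      have := congrArg (Int.cast (R := ℚ)) hs
      rwa [Int.cast_mul, Int.cast_natCast] at this
    rw [← hk, zsmul_eq_mul, zsmul_eq_mul, hs']
    push_cast
    ring
  have h3 : c.natAbs = 1 := by
    obtain ⟨t, ht⟩ := h2
    have h4 : n * (c.natAbs * t) = n * 1 := by rw [← mul_assoc, ← ht, mul_one]
    exact Nat.eq_one_of_mul_eq_one_right
      (Nat.eq_of_mul_eq_mul_left (Nat.pos_of_ne_zero (hn.ne_zero hL)) h4)
  rw [hg, AddSubgroup.mem_zmultiples_iff]
  refine ⟨c, ?_⟩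
  rw [smul_smul]
  rcases Int.natAbs_eq c with h | h <;> rw [h, h3] <;> simp

/-- The distance divides the reduced norm of every integral linking ideal. -/
theorem IsDistance.dvd_of_links (h : IsDistance O O' m) {n : ℕ}
    (hL : IsIntegralIdeal L.toAddSubgroup)
    (hl : Links L.toAddSubgroup O.toAddSubgroup O'.toAddSubgroup)
    (hn : IsReducedNorm L.toAddSubgroup n) : m ∣ n := by
  have hn0 : (n : ℚ) ≠ 0 := Nat.cast_ne_zero.2 (hn.ne_zero hL.1)
  have hOL : ∀ x ∈ O, ∀ y ∈ L, x * y ∈ L := by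
    intro x hx
    have : x ∈ leftOrder L.toAddSubgroup := by rw [hl.1]; exact hx
    exact this
  have hLO' : ∀ x ∈ O', ∀ y ∈ L, y * x ∈ L := by
    intro x hx
    have : x ∈ rightOrder L.toAddSubgroup := by rw [hl.2]; exact hx
    exact this
  have hLO : ∀ x ∈ L, x ∈ O := by
    intro x hx
    have h1 : x ∈ leftOrder L.toAddSubgroup := hL.2 x hx
    rw [hl.1] at h1
    exact h1
  -- For `z ∈ L`, `nrd z · uv = u z̄ z v`, and `z̄ ∈ O` since `L ⊆ O`. With `q = n` this yields `n O
  -- O' ⊆ L`.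
  have hmul : ∀ x ∈ O * O', ∀ q ∈ AddSubgroup.closure (nrd '' (L : Set ℍ[ℚ, a, b])),
      q • x ∈ L := by
    intro x hx q hq
    induction hq using AddSubgroup.closure_induction with
    | zero => rw [zero_smul]; exact L.zero_mem
    | add p q _ _ hp hq => rw [add_smul]; exact L.add_mem hp hq
    | neg p _ hp => rw [neg_smul]; exact L.neg_mem hp
    | mem q hq =>
      obtain ⟨z, hz, rfl⟩ := hq
      induction hx using Submodule.mul_induction_on' with
      | mem_mul_mem u hu v hv =>
        have h1 : nrd z • (u * v) = u * (star z * z * v) := by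
          rw [star_mul_eq_nrd_smul, smul_mul_assoc, one_mul, mul_smul_comm]
        rw [h1, mul_assoc]
        exact hOL u hu _ (hOL _ (h.left_maximal.1.star_mem (hLO z hz)) _ (hLO' v hv z hz))
      | add u _ v _ hu hv => rw [smul_add]; exact L.add_mem hu hv
  -- From `n² nrd x ∈ n ℤ` on `O O'` it follows that `n nrd x` is integral there, hence so is `n /
  -- m`.
  have h1 := h.inv_induction ((AddSubgroup.zmultiples (1 : ℚ)).comap
    (AddMonoidHom.mulLeft (n : ℚ))) fun x hx => by
      obtain ⟨k, hk⟩ := hn.1 _ (hmul x hx n (hn.mem_closure hL.1))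
      rw [nrd_smul] at hk
      refine AddSubgroup.mem_zmultiples_iff.2 ⟨k, ?_⟩
      rw [zsmul_eq_mul, mul_one, AddMonoidHom.coe_mulLeft]
      apply mul_left_cancel₀ hn0
      rw [← hk]; ring
  obtain ⟨k, hk⟩ := AddSubgroup.mem_zmultiples_iff.1 h1
  have hm : (m : ℚ) ≠ 0 := by have := h.pos; positivity
  have hk' : (n : ℚ) = m * k := by
    rw [zsmul_eq_mul, mul_one, AddMonoidHom.coe_mulLeft] at hk
    rw [hk]; field_simp
  have h2 : (m : ℤ) ∣ n := ⟨k, by exact_mod_cast hk'⟩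
  exact_mod_cast h2

end Linking

end QuatOrder

/-- The argument is global and uniform in the quaternion algebra: the key point is that an element
of integral norm pairing integrally with a maximal order lies in it, so that the ramification
hypothesis is not needed. -/
theorem lemma4p2 (p : ℕ) [Fact p.Prime] (a b : ℚ)
    (hB : QuatOrder.RamifiesExactlyAt a b p)
    (O O' : AddSubgroup ℍ[ℚ, a, b])
    (hO : QuatOrder.IsMaximalOrder O) (hO' : QuatOrder.IsMaximalOrder O') :
    ∃ d : ℕ, 0 < d ∧
      (O ⊓ O').relIndex O = d ∧
      (O ⊓ O').relIndex O' = d ∧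
      IsLeast {n : ℕ | ∃ I : AddSubgroup ℍ[ℚ, a, b],
        QuatOrder.IsIntegralIdeal I ∧ QuatOrder.Links I O O' ∧ QuatOrder.IsReducedNorm I n} d := by
  obtain ⟨d, h⟩ := QuatOrder.exists_isDistance (O := AddSubgroup.toIntSubmodule O)
    (O' := AddSubgroup.toIntSubmodule O') hO hO'
  refine ⟨d, h.pos, h.relIndex_inf, ?_, ⟨_, ⟨h.isIdeal_linking, fun x hx y hy => ?_⟩,
    h.links_linking, h.isReducedNorm_linking⟩, ?_⟩
  · rw [inf_comm]
    exact h.symm.relIndex_inf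
  · have := Submodule.mul_mem_mul hx hy
    rwa [h.linking_mul_self] at this
  · rintro n ⟨I, hI, hl, hn⟩
    exact Nat.le_of_dvd
      (Nat.pos_of_ne_zero (hn.ne_zero (L := AddSubgroup.toIntSubmodule I) hI.1))
      (h.dvd_of_links (L := AddSubgroup.toIntSubmodule I) hI hl hn)
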